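/- Consider $N$ agents, $i\in\mathcal I=\{1,\dots,N\}$, with disturbance-free uncertain linear dynamics $$\dot x_i=A_i(\mu_i)x_i+B_i(\mu_i)u_i,\qquad y_i=C_i(\mu_i)x_i,$$ where $x_i\in\mathbb R^{n_i}$, $u_i\in\mathbb R^{m_i}$, $y_i\in\mathbb R^{p_i}$, $A_i(\mu_i)=A_i+\Delta A_i$, $B_i(\mu_i)=B_i+\Delta B_i$, $C_i(\mu_i)=C_i+\Delta C_i$ with known nominal matrices $A_i,B_i,C_i$, and $\mu=(\mu_1,\dots,\mu_N)$, where the uncertainty $\mu_i$ collects the entries of $\Delta A_i,\Delta B_i,\Delta C_i$. Agent $i$ has the cost $$J_i(y)=y_i^{\top}R_{ii}y_i+Q_{ii}y_i+q_i+\sum_{j\ne i}\bigl(y_i^{\top}R_{ij}y_j+y_j^{\top}Q_{ij}y_j\bigr),$$ where $v^\top R_{ii}v>0$ for all $v\ne0$ (no symmetry is required), and $R_{ij}=0$, $Q_{ij}=0$ whenever $j\neq i$ is not a neighbor of $i$ in the communication digraph, i.e. whenever there is no edge from $j$ to $i$. Let $\bar R$ be the block matrix with diagonal blocks $R_{ii}+R_{ii}^\top$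 and off-diagonal blocks $R_{ij}$, and let $\bar Q=\operatorname{col}(Q_{11}^\top,\dots,Q_{NN}^\top)$. Assume that * $\bar R$ is positive definite, i.e. $v^\top\bar Rv>0$ for all $v\ne0$ (again without symmetry); * each pair $(A_i,B_i)$ is stabilizable and each pair $(A_i,C_i)$ is detectable; * $\operatorname{rank}\begin{bmatrix}A_i&B_i\\ C_i&0\end{bmatrix}=n_i+p_i$ for each $i$; * the communication digraph has no directed cycle. Then the game has a unique Nash equilibrium $y^*$ (a point at which no agent can lower its cost by changing its own $y_i$ alone), it satisfies $\bar Ry^*+\bar Q=0$, and there exist matrices $L_i,K_{i1},K_{i2}$ ($i\in\mathcal I$), independent of $\mu$, such that every $A_i-L_i(R_{ii}+R_{ii}^\top)C_i$ is Hurwitz (all its eigenvalues have negative real part) and such that the distributed controller $$\dot\eta_i=M_{i1}\eta_i+M_{i2}e_i,\qquad u_i=[K_{i1}\;\;K_{i2}]\,\eta_i,\qquad e_i=\nabla_{y_i}J_i(y),$$ $$M_{i1}=\begin{bmatrix}A_i+B_iK_{i1}-L_i(R_{ii}+R_{ii}^{\top})C_i & B_iK_{i2}\\ 0&0_{p_i\times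 p_i}\end{bmatrix},\qquad M_{i2}=\begin{bmatrix}L_i\\ I_{p_i}\end{bmatrix},$$ whose internal model is the pure integrator $(0_{p_i\times p_i},I_{p_i})$, solves the Nash equilibrium seeking problem robustly: for every $\mu$ in some neighborhood of $\mu=0$ (in particular for $\mu=0$), 1. the closed loop is stable, i.e. the system matrix of the closed-loop affine system in the variables $(x_1,\dots,x_N,\eta_1,\dots,\eta_N)$ is Hurwitz; 2. along every closed-loop trajectory, for all initial values, $y(t)=\operatorname{col}(y_1(t),\dots,y_N(t))\to y^*$ as $t\to\infty$. -/

import Mathlib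

open Matrix Filter Topology

/-- A real square matrix is Hurwitz: all its complex eigenvalues have negative real part. -/
def IsHurwitz {ι : Type*} [Fintype ι] [DecidableEq ι] (M : Matrix ι ι ℝ) : Prop :=
  ∀ z ∈ spectrum ℂ (M.map (algebraMap ℝ ℂ)), z.re < 0

/-- `(A, B)` is stabilizable: some state feedback makes `A + B K` Hurwitz. -/
def IsStabilizable {n m : ℕ} (A : Matrix (Fin n) (Fin n) ℝ) (B : Matrix (Fin n) (Fin m) ℝ) :
    Prop :=
  ∃ K : Matrix (Fin m) (Fin n) ℝ, IsHurwitz (A + B * K)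

/-- `(A, C)` is detectable: some output injection makes `A - L C` Hurwitz. -/
def IsDetectable {n p : ℕ} (A : Matrix (Fin n) (Fin n) ℝ) (C : Matrix (Fin p) (Fin n) ℝ) :
    Prop :=
  ∃ L : Matrix (Fin n) (Fin p) ℝ, IsHurwitz (A - L * C)

/-- Positive definiteness of a real square matrix that need not be symmetric:
`vᵀ M v > 0` for every nonzero `v`. -/
def IsPosDefForm {ι : Type*} [Fintype ι] (M : Matrix ι ι ℝ) : Prop :=
  ∀ v : ι → ℝ, v ≠ 0 → 0 < v ⬝ᵥ (M *ᵥ v)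

/-- `col(v₁, …, v_N)`. -/
def stack {N : ℕ} {κ : Fin N → Type*} (v : ∀ i, κ i → ℝ) : (Σ i, κ i) → ℝ :=
  fun a => v a.1 a.2

/-- The data of a linear-quadratic network game among `N` disturbance-free linear agents with
state, input and output dimensions `n i`, `m i`, `p i`. -/
structure NetworkGame (N : ℕ) (n m p : Fin N → ℕ) where
  /-- nominal system matrices -/
  A : ∀ i, Matrix (Fin (n i)) (Fin (n i)) ℝ
  /-- nominal input matrices -/
  B : ∀ i, Matrix (Fin (n i)) (Fin (m i)) ℝ
  /-- nominal output matrices -/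
  C : ∀ i, Matrix (Fin (p i)) (Fin (n i)) ℝ
  /-- `R i j` weighs `y_iᵀ R_ij y_j` in the cost of agent `i` (also for `j = i`) -/
  R : ∀ i j, Matrix (Fin (p i)) (Fin (p j)) ℝ
  /-- the row `Q_ii` of the linear term `Q_ii y_i` -/
  Q : ∀ i, Fin (p i) → ℝ
  /-- the constant term -/
  q : Fin N → ℝ
  /-- `W i j`, for `j ≠ i`, is the matrix `Q_ij` of the term `y_jᵀ Q_ij y_j` in the cost
  of agent `i`; `W i i` is not used -/
  W : ∀ _ j : Fin N, Matrix (Fin (p j)) (Fin (p j)) ℝ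
  /-- the communication digraph: `edge j i` means that there is an edge from `j` to `i`,
  i.e. `j` is a neighbor of `i` (agent `i` receives information from `j`) -/
  edge : Fin N → Fin N → Prop

/-- The uncertainty `μ`: for each agent the perturbations `(ΔA_i, ΔB_i, ΔC_i)`. -/
abbrev Uncertainty (N : ℕ) (n m p : Fin N → ℕ) : Type :=
  ∀ i : Fin N, Matrix (Fin (n i)) (Fin (n i)) ℝ × Matrix (Fin (n i)) (Fin (m i)) ℝ ×
    Matrix (Fin (p i)) (Fin (n i)) ℝ

/-- The gains `L_i`, `K_i1`, `K_i2` of the distributed controller. -/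
structure Gains (N : ℕ) (n m p : Fin N → ℕ) where
  L : ∀ i, Matrix (Fin (n i)) (Fin (p i)) ℝ
  K₁ : ∀ i, Matrix (Fin (m i)) (Fin (n i)) ℝ
  K₂ : ∀ i, Matrix (Fin (m i)) (Fin (p i)) ℝ

namespace NetworkGame

/-- `A_i(μ_i) = A_i + ΔA_i`. -/
def Aμ {N : ℕ} {n m p : Fin N → ℕ} (G : NetworkGame N n m p) (μ : Uncertainty N n m p)
    (i : Fin N) : Matrix (Fin (n i)) (Fin (n i)) ℝ := G.A i + (μ i).1

/-- `B_i(μ_i) = B_i + ΔB_i`. -/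
def Bμ {N : ℕ} {n m p : Fin N → ℕ} (G : NetworkGame N n m p) (μ : Uncertainty N n m p)
    (i : Fin N) : Matrix (Fin (n i)) (Fin (m i)) ℝ := G.B i + (μ i).2.1

/-- `C_i(μ_i) = C_i + ΔC_i`. -/
def Cμ {N : ℕ} {n m p : Fin N → ℕ} (G : NetworkGame N n m p) (μ : Uncertainty N n m p)
    (i : Fin N) : Matrix (Fin (p i)) (Fin (n i)) ℝ := G.C i + (μ i).2.2

/-- The cost `J_i(y)` of agent `i`. -/
def cost {N : ℕ} {n m p : Fin N → ℕ} (G : NetworkGame N n m p) (i : Fin N)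
    (y : ∀ j, Fin (p j) → ℝ) : ℝ :=
  y i ⬝ᵥ (G.R i i *ᵥ y i) + G.Q i ⬝ᵥ y i + G.q i +
    ∑ j ∈ Finset.univ.erase i, (y i ⬝ᵥ (G.R i j *ᵥ y j) + y j ⬝ᵥ (G.W i j *ᵥ y j))

/-- Nash equilibrium: no agent can lower its cost by changing its own output alone. -/
def IsNash {N : ℕ} {n m p : Fin N → ℕ} (G : NetworkGame N n m p)
    (y : ∀ j, Fin (p j) → ℝ) : Prop :=
  ∀ (i : Fin N) (v : Fin (p i) → ℝ), G.cost i y ≤ G.cost i (Function.update y i v)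

/-- The local partial gradient `∇_i J_i(y)`: the vector of the partial derivatives of `J_i` with
respect to the coordinates of `y_i`. -/
noncomputable def partialGrad {N : ℕ} {n m p : Fin N → ℕ} (G : NetworkGame N n m p) (i : Fin N)
    (y : ∀ j, Fin (p j) → ℝ) : Fin (p i) → ℝ :=
  fun k => deriv
    (fun s => G.cost i (Function.update y i (Function.update (y i) k s))) (y i k)

/-- The blocks of `R̄`: `R_ii + R_iiᵀ` on the diagonal and `R_ij` off the diagonal. -/
def RbarBlock {N : ℕ} {n m p : Fin N → ℕ} (G : NetworkGame N n m p) (i j : Fin N) :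
    Matrix (Fin (p i)) (Fin (p j)) ℝ :=
  if i = j then G.R i j + (G.R j i)ᵀ else G.R i j

/-- The matrix `R̄` of the pseudo-gradient `F(y) = R̄ y + Q̄`. -/
def Rbar {N : ℕ} {n m p : Fin N → ℕ} (G : NetworkGame N n m p) :
    Matrix (Σ i, Fin (p i)) (Σ i, Fin (p i)) ℝ :=
  Matrix.of fun a b => G.RbarBlock a.1 b.1 a.2 b.2

/-- The vector `Q̄ = col(Q_11ᵀ, …, Q_NNᵀ)`. -/
def Qbar {N : ℕ} {n m p : Fin N → ℕ} (G : NetworkGame N n m p) : (Σ i, Fin (p i)) → ℝ :=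
  stack G.Q

/-- `J_i` only involves the outputs of `i` and of its neighbors: `R_ij = 0` and `Q_ij = 0` when
`j ≠ i` is not a neighbor of `i`. -/
def CostsRespectGraph {N : ℕ} {n m p : Fin N → ℕ} (G : NetworkGame N n m p) : Prop :=
  ∀ i j : Fin N, j ≠ i → ¬ G.edge j i → G.R i j = 0 ∧ G.W i j = 0

/-- The communication digraph has no directed cycle. -/
def GraphAcyclic {N : ℕ} {n m p : Fin N → ℕ} (G : NetworkGame N n m p) : Prop :=
  ∀ i : Fin N, ¬ Relation.TransGen G.edge i i

/-- `M_i1 = [[A_i + B_i K_i1 - L_i (R_ii + R_iiᵀ) C_i, B_i K_i2], [0, 0]]`. -/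
def M₁ {N : ℕ} {n m p : Fin N → ℕ} (G : NetworkGame N n m p) (g : Gains N n m p) (i : Fin N) :
    Matrix (Fin (n i) ⊕ Fin (p i)) (Fin (n i) ⊕ Fin (p i)) ℝ :=
  Matrix.fromBlocks
    (G.A i + G.B i * g.K₁ i - g.L i * (G.R i i + (G.R i i)ᵀ) * G.C i) (G.B i * g.K₂ i) 0 0

end NetworkGame

namespace Gains

/-- `M_i2 = [L_i; I]`. -/
def M₂ {N : ℕ} {n m p : Fin N → ℕ} (g : Gains N n m p) (i : Fin N) :
    Matrix (Fin (n i) ⊕ Fin (p i)) (Fin (p i)) ℝ :=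
  Matrix.fromRows (g.L i) 1

/-- `K_i = [K_i1, K_i2]`. -/
def K {N : ℕ} {n m p : Fin N → ℕ} (g : Gains N n m p) (i : Fin N) :
    Matrix (Fin (m i)) (Fin (n i) ⊕ Fin (p i)) ℝ :=
  Matrix.fromCols (g.K₁ i) (g.K₂ i)

end Gains

namespace NetworkGame

/-- The outputs `y_i = C_i(μ_i) x_i`. -/
def output {N : ℕ} {n m p : Fin N → ℕ} (G : NetworkGame N n m p) (μ : Uncertainty N n m p)
    (x : ∀ i, Fin (n i) → ℝ) : ∀ i, Fin (p i) → ℝ :=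
  fun i => G.Cμ μ i *ᵥ x i

/-- `(x, η)` is a trajectory on `[0, ∞)` of the closed loop of the agents
`ẋ_i = A_i(μ_i) x_i + B_i(μ_i) u_i`, `y_i = C_i(μ_i) x_i` with the controller
`η̇_i = M_i1 η_i + M_i2 e_i`, `u_i = K_i η_i`, where `e_i = ∇_i J_i(y)`. -/
def IsTrajectory {N : ℕ} {n m p : Fin N → ℕ} (G : NetworkGame N n m p) (g : Gains N n m p)
    (μ : Uncertainty N n m p) (x : ∀ i, ℝ → Fin (n i) → ℝ)
    (η : ∀ i, ℝ → Fin (n i) ⊕ Fin (p i) → ℝ) : Prop :=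
  ∀ i, ∀ t ∈ Set.Ici (0 : ℝ),
    HasDerivWithinAt (x i) (G.Aμ μ i *ᵥ x i t + G.Bμ μ i *ᵥ (g.K i *ᵥ η i t)) (Set.Ici 0) t ∧
    HasDerivWithinAt (η i)
      (G.M₁ g i *ᵥ η i t + g.M₂ i *ᵥ G.partialGrad i (G.output μ fun j => x j t)) (Set.Ici 0) t

/-- The system matrix of the closed loop, in the coordinates
`(col(x_1, …, x_N), col(η_1, …, η_N))`. -/
def closedLoopMatrix {N : ℕ} {n m p : Fin N → ℕ} (G : NetworkGame N n m p) (g : Gains N n m p)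
    (μ : Uncertainty N n m p) :
    Matrix ((Σ i, Fin (n i)) ⊕ (Σ i, Fin (n i) ⊕ Fin (p i)))
      ((Σ i, Fin (n i)) ⊕ (Σ i, Fin (n i) ⊕ Fin (p i))) ℝ :=
  Matrix.fromBlocks
    (Matrix.blockDiagonal' (G.Aμ μ)) (Matrix.blockDiagonal' fun i => G.Bμ μ i * g.K i)
    (Matrix.blockDiagonal' g.M₂ * G.Rbar * Matrix.blockDiagonal' (G.Cμ μ))
    (Matrix.blockDiagonal' (G.M₁ g))

end NetworkGame

/-! Each cost is a strictly convex quadratic in the agent's own output, so the Nash equilibria are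
exactly the zeros of the pseudo-gradient `R̄ y + Q̄` (`isNash_iff`). Positive definiteness makes
`R̄` invertible, so there is exactly one.

For an isolated agent, put `S = R_ii + R_iiᵀ`, let `K` stabilize the plant, `T = (A + B K)⁻¹`, and
let `H` be a right inverse of `S C T B`, which exists by the rank condition. The gains `K₁ = K - H S
C T`, `K₂ = H` make the loop triangular in the observer error `x - ξ`, the shifted integrator state
`ζ - S C T x` and the state `x`. The eigenvalues are then those of the observer, `-1`, and those of
`A + B K`.

At `μ = 0` an eigenvector of the network with eigenvalue in the closed right half-plane vanishes
agent by agent along the acyclic graph: once the neighbors' components vanish, agent `i` is isolated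
(`isHurwitz_closedLoopMatrix_zero`). Being Hurwitz is an open condition, so stability persists for
small `μ`.

A stable affine system converges to its equilibrium, where the integrator rows, untouched by `μ`,
force the pseudo-gradient to be zero. Hence the outputs tend to `y*` (`tendsto_output`). -/

/-! ### Hurwitz matrices: eigenvector criterion and openness. -/

section Hurwitz

variable {ι : Type*} [Fintype ι] [DecidableEq ι]

lemma Matrix.mem_spectrum_iff_det_eq_zero {𝕜 : Type*} [Field 𝕜] {M : Matrix ι ι 𝕜} {z : 𝕜} :
    z ∈ spectrum 𝕜 M ↔ (M - z • 1).det = 0 := by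
  rw [spectrum.mem_iff, Matrix.isUnit_iff_isUnit_det, isUnit_iff_ne_zero, not_not,
    Algebra.algebraMap_eq_smul_one, ← neg_sub M, Matrix.det_neg]
  simp

lemma Matrix.mem_spectrum_iff_exists_mulVec {𝕜 : Type*} [Field 𝕜] {M : Matrix ι ι 𝕜} {z : 𝕜} :
    z ∈ spectrum 𝕜 M ↔ ∃ v, v ≠ 0 ∧ M *ᵥ v = z • v := by
  rw [Matrix.mem_spectrum_iff_det_eq_zero, ← Matrix.exists_mulVec_eq_zero_iff]
  simp only [Matrix.sub_mulVec, Matrix.smul_mulVec, Matrix.one_mulVec, sub_eq_zero]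

/-- The eigenvector form lets stability of a block system be checked component by component, with no
computation of determinants. -/
lemma isHurwitz_iff {M : Matrix ι ι ℝ} :
    IsHurwitz M ↔ ∀ z : ℂ, 0 ≤ z.re → ∀ v : ι → ℂ,
      M.map (algebraMap ℝ ℂ) *ᵥ v = z • v → v = 0 := by
  constructor
  · intro h z hz v hv
    by_contra h0
    exact absurd (h z (Matrix.mem_spectrum_iff_exists_mulVec.2 ⟨v, h0, hv⟩)) (not_lt.2 hz)
  · intro h z hz
    obtain ⟨v, h0, hv⟩ := Matrix.mem_spectrum_iff_exists_mulVec.1 hz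
    by_contra hre
    exact h0 (h z (not_lt.1 hre) v hv)

lemma IsHurwitz.isUnit_det {M : Matrix ι ι ℝ} (h : IsHurwitz M) : IsUnit M.det := by
  rw [isUnit_iff_ne_zero]
  intro h0
  have h1 : (0 : ℂ) ∈ spectrum ℂ (M.map (algebraMap ℝ ℂ)) := by
    rw [Matrix.mem_spectrum_iff_det_eq_zero, zero_smul, sub_zero]
    have := (algebraMap ℝ ℂ).map_det M
    rw [h0, map_zero] at this
    exact this.symm
  simpa using h 0 h1

lemma Matrix.norm_mulVec_le_sum_norm {κ : Type*} [Fintype κ] (M : Matrix κ κ ℂ) (v : κ → ℂ) :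
    ‖M *ᵥ v‖ ≤ (∑ i, ∑ j, ‖M i j‖) * ‖v‖ := by
  refine (pi_norm_le_iff_of_nonneg (by positivity)).2 fun i => ?_
  calc ‖(M *ᵥ v) i‖ ≤ ∑ j, ‖M i j * v j‖ := norm_sum_le _ _
    _ ≤ ∑ j, ‖M i j‖ * ‖v‖ := by
        gcongr with j
        rw [norm_mul]
        gcongr
        exact norm_le_pi_norm v j
    _ = (∑ j, ‖M i j‖) * ‖v‖ := by rw [Finset.sum_mul]
    _ ≤ _ := mul_le_mul_of_nonneg_right
        (Finset.single_le_sum (f := fun i => ∑ j, ‖M i j‖) (fun _ _ => by positivity)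
          (Finset.mem_univ i)) (norm_nonneg v)

/-- The entry sum `b` bounds all eigenvalues, so for `M'` near `M` only the compact half-disc `S`
can contain an unstable one. The characteristic determinant has no zero on `S` at `M`, and by
compactness none for nearby `M'`. -/
lemma IsHurwitz.eventually {M : Matrix ι ι ℝ} (h : IsHurwitz M) : ∀ᶠ M' in 𝓝 M, IsHurwitz M' := by
  let b : Matrix ι ι ℝ → ℝ := fun M' => ∑ i, ∑ j, ‖M'.map (algebraMap ℝ ℂ) i j‖
  have hb : Continuous b := by
    refine continuous_finsetSum _ fun i _ => continuous_finsetSum _ fun j _ => ?_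
    simp only [Matrix.map_apply]
    exact ((algebraMapCLM ℝ ℂ).continuous.comp (continuous_id.matrix_elem i j)).norm
  let S : Set ℂ := Metric.closedBall 0 (b M + 1) ∩ {z | 0 ≤ z.re}
  have hS : IsCompact S := (isCompact_closedBall _ _).inter_right
    (isClosed_le continuous_const Complex.continuous_re)
  have hdet : Continuous fun q : Matrix ι ι ℝ × ℂ =>
      (q.1.map (algebraMap ℝ ℂ) - q.2 • (1 : Matrix ι ι ℂ)).det := by
    refine Continuous.matrix_det (Continuous.sub ?_ (continuous_snd.smul continuous_const))
    exact continuous_fst.matrix_map (algebraMapCLM ℝ ℂ).continuous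
  have h1 : ∀ᶠ M' in 𝓝 M, ∀ z ∈ S,
      (Matrix.map M' (algebraMap ℝ ℂ) - z • (1 : Matrix ι ι ℂ)).det ≠ 0 := by
    refine hS.eventually_forall_of_forall_eventually fun z hz => ?_
    refine (hdet.continuousAt (x := (M, z))).eventually_ne fun h0 => ?_
    exact absurd (h z (Matrix.mem_spectrum_iff_det_eq_zero.2 h0)) (not_lt.2 hz.2)
  have h2 : ∀ᶠ M' in 𝓝 M, b M' < b M + 1 :=
    hb.continuousAt.eventually_lt continuousAt_const (by linarith)
  filter_upwards [h1, h2] with M' h1 h2 z hz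
  by_contra hre
  refine h1 z ⟨?_, not_lt.1 hre⟩ (Matrix.mem_spectrum_iff_det_eq_zero.1 hz)
  obtain ⟨v, h0, hv⟩ := Matrix.mem_spectrum_iff_exists_mulVec.1 hz
  have h3 := Matrix.norm_mulVec_le_sum_norm (M'.map (algebraMap ℝ ℂ)) v
  rw [hv, norm_smul] at h3
  have h4 : ‖z‖ ≤ b M' := le_of_mul_le_mul_right h3 (norm_pos_iff.2 h0)
  rw [mem_closedBall_zero_iff]
  linarith

end Hurwitz

/-! ### Decay of trajectories of stable linear systems. -/

section Decay

/-- A stable scalar-rate linear equation forced by a vanishing input has vanishing solutions. -/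
lemma tendsto_zero_of_hasDerivWithinAt_smul_add {E : Type*} [NormedAddCommGroup E]
    [NormedSpace ℂ E] {f g : ℝ → E} {l : ℂ} (hl : l.re < 0)
    (hf : ∀ t ∈ Set.Ici (0 : ℝ), HasDerivWithinAt f (l • f t + g t) (Set.Ici 0) t)
    (hg : Tendsto g atTop (𝓝 0)) : Tendsto f atTop (𝓝 0) := by
  set a : ℝ := -l.re with ha
  have ha0 : 0 < a := by linarith
  have hnexp : ∀ t : ℝ, ‖Complex.exp (-(l * t))‖ = Real.exp (a * t) := fun t => by
    rw [Complex.norm_exp]; simp [ha]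
  -- Integrating factor: it removes the term `l • f` and leaves a derivative controlled by `g`
  -- alone.
  let h : ℝ → E := fun t => Complex.exp (-(l * t)) • f t
  have hh : ∀ t ∈ Set.Ici (0 : ℝ),
      HasDerivWithinAt h (Complex.exp (-(l * t)) • g t) (Set.Ici 0) t := fun t ht => by
    have e1 : HasDerivAt (fun s : ℝ => Complex.exp (-(l * s)))
        (Complex.exp (-(l * t)) * -(l * 1)) t :=
      (((Complex.ofRealCLM.hasDerivAt (x := t)).const_mul l).neg).cexp
    refine (e1.hasDerivWithinAt.smul (hf t ht)).congr_deriv ?_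
    rw [smul_add, smul_smul]
    module
  rw [Metric.tendsto_atTop]
  intro ε hε
  -- With `‖g‖` below `ε * a / 2`, integrating against `exp (a * s)` contributes at most `ε / 2`
  -- after multiplication by `exp (-(a * t))`.
  have hg' := (Metric.tendsto_atTop.1 hg) (ε * a / 2) (by positivity)
  obtain ⟨T₀, hT₀⟩ := hg'
  set T := max T₀ 0
  have hT : 0 ≤ T := le_max_right _ _
  have key : ∀ t, T ≤ t → ‖h t‖ ≤ ‖h T‖ + ε / 2 * (Real.exp (a * t) - Real.exp (a * T)) := by
    intro t ht
    refine image_norm_le_of_norm_deriv_right_le_deriv_boundary (a := T) (b := t)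
      (f' := fun s => Complex.exp (-(l * s)) • g s)
      (B := fun s => ‖h T‖ + ε / 2 * (Real.exp (a * s) - Real.exp (a * T)))
      (B' := fun s => ε / 2 * (Real.exp (a * s) * a)) ?_ ?_ ?_ ?_ ?_ ⟨ht, le_rfl⟩
    · exact fun s hs => ((hh s (hT.trans hs.1)).continuousWithinAt).mono
        fun r hr => hT.trans hr.1
    · exact fun s hs => (hh s (hT.trans hs.1)).mono
        fun r hr => (hT.trans hs.1).trans hr
    · simp
    · intro s
      have e2 : HasDerivAt (fun s : ℝ => Real.exp (a * s)) (Real.exp (a * s) * a) s := by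
        simpa using ((hasDerivAt_id s).const_mul a).exp
      exact ((e2.sub_const _).const_mul _).const_add _
    · intro s hs
      rw [norm_smul, hnexp]
      have := hT₀ s ((le_max_left _ _).trans hs.1)
      rw [dist_zero_right] at this
      calc Real.exp (a * s) * ‖g s‖ ≤ Real.exp (a * s) * (ε * a / 2) := by gcongr
        _ = _ := by ring
  have hdecay : Tendsto (fun t : ℝ => Real.exp (-(a * t)) * ‖h T‖) atTop (𝓝 0) := by
    have : Tendsto (fun t : ℝ => Real.exp (-(a * t))) atTop (𝓝 0) :=
      Real.tendsto_exp_neg_atTop_nhds_zero.comp (tendsto_id.const_mul_atTop ha0)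
    simpa using this.mul_const ‖h T‖
  obtain ⟨T₁, hT₁⟩ := (Metric.tendsto_atTop.1 hdecay) (ε / 2) (by positivity)
  refine ⟨max T T₁, fun t ht => ?_⟩
  have h1 := key t ((le_max_left _ _).trans ht)
  have h2 := hT₁ t ((le_max_right _ _).trans ht)
  rw [dist_zero_right, Real.norm_eq_abs, abs_of_nonneg (by positivity)] at h2
  rw [dist_zero_right]
  have h3 : ‖f t‖ = Real.exp (-(a * t)) * ‖h t‖ := by
    rw [norm_smul, hnexp, ← mul_assoc, ← Real.exp_add]; simp
  have h4 : Real.exp (-(a * t)) * Real.exp (a * t) = 1 := by rw [← Real.exp_add]; simp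
  calc ‖f t‖ = Real.exp (-(a * t)) * ‖h t‖ := h3
    _ ≤ Real.exp (-(a * t)) * (‖h T‖ + ε / 2 * (Real.exp (a * t) - Real.exp (a * T))) := by
        gcongr
    _ = Real.exp (-(a * t)) * ‖h T‖ + ε / 2 * (Real.exp (-(a * t)) * Real.exp (a * t))
          - ε / 2 * (Real.exp (-(a * t)) * Real.exp (a * T)) := by ring
    _ < ε := by
        rw [h4]
        have : 0 < ε / 2 * (Real.exp (-(a * t)) * Real.exp (a * T)) := by positivity
        linarith

variable {ι : Type*} [Fintype ι]

lemma hasDerivWithinAt_mulVec {𝕜 κ : Type*} [Fintype κ] [NontriviallyNormedField 𝕜]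
    [NormedAlgebra ℝ 𝕜] (P : Matrix κ ι 𝕜)
    {w : ℝ → ι → 𝕜} {w' : ι → 𝕜} {s : Set ℝ} {t : ℝ} (h : HasDerivWithinAt w w' s t) :
    HasDerivWithinAt (fun t => P *ᵥ w t) (P *ᵥ w') s t := by
  rw [hasDerivWithinAt_pi] at h ⊢
  intro i
  exact HasDerivWithinAt.fun_sum fun j _ => (h j).const_mul (P i j)

variable [DecidableEq ι]

/-- Factors are peeled off one at a time: if `P` is the product over the tail, then `f = P w`
satisfies `f' = z f + g`, where `g = (M - z) P w` already tends to zero. This replaces the matrix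
exponential and the Jordan form. -/
lemma tendsto_zero_of_tendsto_prod_mulVec {M : Matrix ι ι ℂ} {w : ℝ → ι → ℂ}
    (hw : ∀ t ∈ Set.Ici (0 : ℝ), HasDerivWithinAt w (M *ᵥ w t) (Set.Ici 0) t)
    (s : List ℂ) (hs : ∀ z ∈ s, z.re < 0)
    (h : Tendsto (fun t => (s.map fun z => M - z • 1).prod *ᵥ w t) atTop (𝓝 0)) :
    Tendsto w atTop (𝓝 0) := by
  induction s with
  | nil => simpa using h
  | cons z s ih =>
    refine ih (fun y hy => hs y (List.mem_cons_of_mem _ hy)) ?_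
    have hcomm : Commute (s.map fun z => M - z • (1 : Matrix ι ι ℂ)).prod M := by
      refine Commute.list_prod_left _ _ fun x hx => ?_
      obtain ⟨y, -, rfl⟩ := List.mem_map.1 hx
      exact (Commute.refl M).sub_left ((Commute.one_left M).smul_left y)
    refine tendsto_zero_of_hasDerivWithinAt_smul_add (hs z List.mem_cons_self) (fun t ht => ?_) h
    refine (hasDerivWithinAt_mulVec _ (hw t ht)).congr_deriv ?_
    rw [List.map_cons, List.prod_cons, Matrix.mulVec_mulVec, hcomm.eq, sub_mul,
      Matrix.sub_mulVec, smul_mul_assoc, one_mul, Matrix.smul_mulVec]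
    abel

/-- Trajectories of `w' = M w` vanish at infinity when `M` is Hurwitz. -/
lemma IsHurwitz.tendsto_zero {M : Matrix ι ι ℝ} (hM : IsHurwitz M) {w : ℝ → ι → ℝ}
    (hw : ∀ t ∈ Set.Ici (0 : ℝ), HasDerivWithinAt w (M *ᵥ w t) (Set.Ici 0) t) :
    Tendsto w atTop (𝓝 0) := by
  set Mc := M.map (algebraMap ℝ ℂ) with hMc
  let wc : ℝ → ι → ℂ := fun t i => (w t i : ℂ)
  have hwc : ∀ t ∈ Set.Ici (0 : ℝ), HasDerivWithinAt wc (Mc *ᵥ wc t) (Set.Ici 0) t := by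
    intro t ht
    rw [hasDerivWithinAt_pi]
    intro i
    have h1 := ((hasDerivWithinAt_pi.1 (hw t ht)) i).ofReal_comp
    refine h1.congr_deriv ?_
    exact (algebraMap ℝ ℂ).map_mulVec M (w t) i
  have h0 : Tendsto wc atTop (𝓝 0) := by
    -- Taking all characteristic roots, the full product is zero by Cayley–Hamilton, which starts
    -- the peeling.
    refine tendsto_zero_of_tendsto_prod_mulVec hwc Mc.charpoly.roots.toList (fun z hz => ?_) ?_
    · refine hM z (Matrix.mem_spectrum_iff_isRoot_charpoly.2 ?_)
      exact Polynomial.isRoot_of_mem_roots (Multiset.mem_toList.1 hz)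
    · have hCH := Mc.aeval_self_charpoly
      rw [(IsAlgClosed.splits Mc.charpoly).eq_prod_roots_of_monic Mc.charpoly_monic,
        ← Multiset.coe_toList Mc.charpoly.roots, Multiset.map_coe, Multiset.prod_coe,
        map_list_prod, List.map_map] at hCH
      have : (Mc.charpoly.roots.toList.map fun z => Mc - z • (1 : Matrix ι ι ℂ)).prod = 0 := by
        rw [← hCH]
        congr 2
        funext z
        simp [Algebra.algebraMap_eq_smul_one]
      simp [this]
  rw [tendsto_pi_nhds] at h0 ⊢
  intro i
  exact (Complex.continuous_re.tendsto 0).comp (h0 i)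

/-- Trajectories of `w' = M w + b` converge to the equilibrium when `M` is Hurwitz. -/
lemma IsHurwitz.tendsto_equilibrium {M : Matrix ι ι ℝ} (hM : IsHurwitz M) {b w₀ : ι → ℝ}
    (hw₀ : M *ᵥ w₀ + b = 0) {w : ℝ → ι → ℝ}
    (hw : ∀ t ∈ Set.Ici (0 : ℝ), HasDerivWithinAt w (M *ᵥ w t + b) (Set.Ici 0) t) :
    Tendsto w atTop (𝓝 w₀) := by
  have h : Tendsto (fun t => w t - w₀) atTop (𝓝 0) := by
    refine hM.tendsto_zero fun t ht => ((hw t ht).sub_const w₀).congr_deriv ?_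
    rw [Matrix.mulVec_sub, eq_neg_of_add_eq_zero_left hw₀, sub_neg_eq_add]
  simpa using h.add_const w₀

end Decay

/-! ### Stabilization of a single agent by observer-based integral control. -/

section Agent

lemma IsPosDefForm.isUnit_det {ι : Type*} [Fintype ι] [DecidableEq ι] {M : Matrix ι ι ℝ}
    (h : IsPosDefForm M) : IsUnit M.det := by
  rw [isUnit_iff_ne_zero]
  intro h0
  obtain ⟨v, hv, hMv⟩ := Matrix.exists_mulVec_eq_zero_iff.2 h0
  simpa [hMv] using h v hv

lemma IsPosDefForm.add_transpose {ι : Type*} [Fintype ι] {M : Matrix ι ι ℝ}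
    (h : IsPosDefForm M) : IsPosDefForm (M + Mᵀ) := by
  intro v hv
  have h1 : v ⬝ᵥ (Mᵀ *ᵥ v) = v ⬝ᵥ (M *ᵥ v) := by
    rw [Matrix.mulVec_transpose, dotProduct_comm, ← Matrix.dotProduct_mulVec]
  rw [Matrix.add_mulVec, dotProduct_add, h1]
  linarith [h v hv]

lemma Matrix.mulVec_surjective_of_rank_eq_card {κ ι 𝕜 : Type*} [Fintype κ] [Fintype ι] [Field 𝕜]
    {M : Matrix κ ι 𝕜} (h : M.rank = Fintype.card κ) : Function.Surjective M.mulVec := by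
  have : LinearMap.range M.mulVecLin = ⊤ :=
    Submodule.eq_top_of_finrank_eq (by rw [← Matrix.rank, h, Module.finrank_fintype_fun_eq_card])
  exact LinearMap.range_eq_top.1 this

/-- Full row rank of `[[A, B], [C, 0]]` makes the static gain `C (A + B K)⁻¹ B` right invertible. -/
lemma Matrix.exists_rightInverse_staticGain {n m p 𝕜 : Type*} [Fintype n] [Fintype m] [Fintype p]
    [DecidableEq n] [DecidableEq p] [Field 𝕜] {A T : Matrix n n 𝕜} {B : Matrix n m 𝕜}
    {C : Matrix p n 𝕜} {K : Matrix m n 𝕜} {S : Matrix p p 𝕜} (hS : IsUnit S.det)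
    (hT : T * (A + B * K) = 1)
    (hrank : (Matrix.fromBlocks A B C 0).rank = Fintype.card n + Fintype.card p) :
    ∃ H : Matrix m p 𝕜, S * C * T * B * H = 1 := by
  rw [← Matrix.mulVec_surjective_iff_exists_right_inverse]
  intro y
  have hs := Matrix.mulVec_surjective_of_rank_eq_card (by rw [hrank, Fintype.card_sum])
  -- The solution gives `A x + B u = 0` and `S C x = -y`. The input `u - K x` then satisfies `B (u -
  -- K x) = -(A + B K) x`, which `T` sends to `-x` and `S C` to `y`.
  obtain ⟨w, hw⟩ := hs (Sum.elim 0 (-(S⁻¹ *ᵥ y)))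
  rw [Matrix.fromBlocks_mulVec] at hw
  set x := w ∘ Sum.inl
  set u := w ∘ Sum.inr
  have h1 : A *ᵥ x + B *ᵥ u = 0 := funext fun i => congrFun hw (Sum.inl i)
  have h2 : C *ᵥ x = -(S⁻¹ *ᵥ y) := by
    rw [← add_zero (C *ᵥ x), ← Matrix.zero_mulVec u]
    exact funext fun i => congrFun hw (Sum.inr i)
  refine ⟨u - K *ᵥ x, ?_⟩
  have h3 : B *ᵥ (u - K *ᵥ x) = -((A + B * K) *ᵥ x) := by
    rw [Matrix.mulVec_sub, Matrix.add_mulVec, ← Matrix.mulVec_mulVec,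
      eq_neg_of_add_eq_zero_right h1]
    abel
  have h4 : T *ᵥ ((A + B * K) *ᵥ x) = x := by
    rw [Matrix.mulVec_mulVec, hT, Matrix.one_mulVec]
  change (S * C * T * B) *ᵥ (u - K *ᵥ x) = y
  rw [← Matrix.mulVec_mulVec, h3, Matrix.mulVec_neg, ← Matrix.mulVec_mulVec, h4,
    ← Matrix.mulVec_mulVec, h2, Matrix.mulVec_neg, neg_neg, Matrix.mulVec_mulVec,
    Matrix.mul_nonsing_inv _ hS, Matrix.one_mulVec]

/-- The observer-based integral controller leaves no eigenvector at `z` if neither the state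
feedback nor the observer has one, and `z ≠ -1`. -/
lemma Matrix.integralControl_eigenvector_eq_zero {n m p 𝕜 : Type*} [Fintype n] [Fintype m]
    [Fintype p] [DecidableEq n] [DecidableEq p] [Field 𝕜] {A T : Matrix n n 𝕜}
    {B : Matrix n m 𝕜} {C : Matrix p n 𝕜} {K : Matrix m n 𝕜} {L : Matrix n p 𝕜}
    {H : Matrix m p 𝕜} {z : 𝕜} (hz : z + 1 ≠ 0)
    (hT : T * (A + B * K) = 1) (hH : C * T * B * H = 1)
    (hK : ∀ v, (A + B * K) *ᵥ v = z • v → v = 0) (hL : ∀ v, (A - L * C) *ᵥ v = z • v → v = 0)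
    {x ξ : n → 𝕜} {ζ : p → 𝕜}
    (h1 : A *ᵥ x + B *ᵥ ((K - H * C * T) *ᵥ ξ + H *ᵥ ζ) = z • x)
    (h2 : L *ᵥ (C *ᵥ x) + ((A + B * (K - H * C * T) - L * C) *ᵥ ξ + (B * H) *ᵥ ζ) = z • ξ)
    (h3 : C *ᵥ x = z • ζ) : x = 0 ∧ ξ = 0 ∧ ζ = 0 := by
  have e1 : x - ξ = 0 := by
    -- The observer error decouples: the input enters plant and observer alike and cancels.
    apply hL
    rw [smul_sub, ← h1, ← h2]
    simp only [Matrix.add_mulVec, Matrix.sub_mulVec, Matrix.mulVec_add, Matrix.mulVec_sub,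
      Matrix.mul_sub, ← Matrix.mulVec_mulVec]
    abel
  obtain rfl : x = ξ := sub_eq_zero.1 e1
  -- In this coordinate the input is `K x + H y`. Since `C T (A + B K) = C` and `C T B H = 1`, the
  -- dynamics of `y` reduce to `y' = -y`.
  set y := ζ - (C * T) *ᵥ x with hy
  have e2 : (A + B * K) *ᵥ x + (B * H) *ᵥ y = z • x := by
    rw [← h1]
    simp only [hy, Matrix.add_mulVec, Matrix.sub_mulVec, Matrix.mulVec_add, Matrix.mulVec_sub,
      ← Matrix.mulVec_mulVec]
    abel
  have e3 : C *ᵥ x + y = z • ((C * T) *ᵥ x) := by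
    rw [← Matrix.mulVec_smul, ← e2, Matrix.mulVec_add, Matrix.mulVec_mulVec, Matrix.mul_assoc C T,
      hT, Matrix.mul_one, Matrix.mulVec_mulVec, ← Matrix.mul_assoc (C * T), hH, Matrix.one_mulVec]
  have e4 : y = 0 := by
    refine (smul_eq_zero.1 (?_ : (z + 1) • y = 0)).resolve_left hz
    rw [add_smul, one_smul]
    nth_rw 1 [hy]
    rw [smul_sub, ← h3, ← e3]
    abel
  have e5 : x = 0 := hK x (by rw [← e2, e4, Matrix.mulVec_zero, add_zero])
  refine ⟨e5, e5, ?_⟩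
  rw [e5, Matrix.mulVec_zero, sub_zero] at hy
  exact hy.symm.trans e4

/-- Gains stabilizing a single agent with the measurement `S C x`. -/
lemma exists_stabilizing_gains {n m p : ℕ} {A : Matrix (Fin n) (Fin n) ℝ}
    {B : Matrix (Fin n) (Fin m) ℝ} {C : Matrix (Fin p) (Fin n) ℝ} {S : Matrix (Fin p) (Fin p) ℝ}
    (hS : IsUnit S.det) (hstab : IsStabilizable A B) (hdet : IsDetectable A C)
    (hrank : (Matrix.fromBlocks A B C 0).rank = n + p) :
    ∃ (L : Matrix (Fin n) (Fin p) ℝ) (K₁ : Matrix (Fin m) (Fin n) ℝ)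
      (K₂ : Matrix (Fin m) (Fin p) ℝ), IsHurwitz (A - L * S * C) ∧
      ∀ z : ℂ, 0 ≤ z.re → ∀ (x ξ : Fin n → ℂ) (ζ : Fin p → ℂ),
        A.map (algebraMap ℝ ℂ) *ᵥ x + B.map (algebraMap ℝ ℂ) *ᵥ
          (K₁.map (algebraMap ℝ ℂ) *ᵥ ξ + K₂.map (algebraMap ℝ ℂ) *ᵥ ζ) = z • x →
        L.map (algebraMap ℝ ℂ) *ᵥ ((S * C).map (algebraMap ℝ ℂ) *ᵥ x) +
          ((A + B * K₁ - L * S * C).map (algebraMap ℝ ℂ) *ᵥ ξ +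
            (B * K₂).map (algebraMap ℝ ℂ) *ᵥ ζ) = z • ξ →
        (S * C).map (algebraMap ℝ ℂ) *ᵥ x = z • ζ → x = 0 ∧ ξ = 0 ∧ ζ = 0 := by
  obtain ⟨K, hK⟩ := hstab
  obtain ⟨L, hL⟩ := hdet
  have hT : (A + B * K)⁻¹ * (A + B * K) = 1 := Matrix.nonsing_inv_mul _ hK.isUnit_det
  obtain ⟨H, hH⟩ := Matrix.exists_rightInverse_staticGain (C := C) hS hT (by simpa using hrank)
  have hL' : L * S⁻¹ * S = L := by
    rw [Matrix.mul_assoc, Matrix.nonsing_inv_mul _ hS, Matrix.mul_one]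
  -- The factor `S⁻¹` compensates the measurement `S C x`, so the observer matrix is `A - L C` for
  -- the detectability gain `L`.
  refine ⟨L * S⁻¹, K - H * (S * C) * (A + B * K)⁻¹, H, by rwa [hL'], ?_⟩
  intro z hz x ξ ζ h1 h2 h3
  have hz1 : z + 1 ≠ 0 := fun h => by
    have := congrArg Complex.re h
    simp at this
    linarith
  have hT' := congrArg (fun M => M.map (algebraMap ℝ ℂ)) hT
  have hH' := congrArg (fun M => M.map (algebraMap ℝ ℂ)) hH
  have hKz := isHurwitz_iff.1 hK z hz
  have hLz := isHurwitz_iff.1 hL z hz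
  rw [← hL', Matrix.mul_assoc (L * S⁻¹)] at hLz
  rw [Matrix.mul_assoc (L * S⁻¹)] at h2
  simp only [Matrix.map_mul, Matrix.map_add _ (map_add (algebraMap ℝ ℂ)),
    Matrix.map_sub _ (map_sub (algebraMap ℝ ℂ)),
    Matrix.map_one _ (map_zero (algebraMap ℝ ℂ)) (map_one (algebraMap ℝ ℂ))]
    at h1 h2 h3 hT' hH' hKz hLz
  exact Matrix.integralControl_eigenvector_eq_zero hz1 hT' hH' hKz hLz h1 h2 h3

end Agent

lemma Matrix.blockDiagonal'_mulVec_apply {o 𝕜 : Type*} [Fintype o] [DecidableEq o]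
    {m' n' : o → Type*} [∀ i, Fintype (n' i)] [NonUnitalNonAssocSemiring 𝕜]
    (D : ∀ i, Matrix (m' i) (n' i) 𝕜) (v : (Σ i, n' i) → 𝕜) (a : Σ i, m' i) :
    (Matrix.blockDiagonal' D *ᵥ v) a = (D a.1 *ᵥ fun l => v ⟨a.1, l⟩) a.2 := by
  obtain ⟨i, k⟩ := a
  simp only [Matrix.mulVec, dotProduct, Fintype.sum_sigma]
  rw [Finset.sum_eq_single i]
  · simp [Matrix.blockDiagonal'_apply_eq]
  · intro j _ hj
    exact Finset.sum_eq_zero fun l _ => by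
      rw [Matrix.blockDiagonal'_apply_ne _ _ _ hj.symm, zero_mul]
  · simp

/-! ### The game: pseudo-gradient and Nash equilibrium. -/

namespace NetworkGame

variable {N : ℕ} {n m p : Fin N → ℕ} (G : NetworkGame N n m p)

/-- The ring homomorphism `f` serves both the real system (identity) and its complexification for
eigenvectors. -/
lemma Rbar_map_mulVec_apply {𝕜 : Type*} [CommRing 𝕜] (f : ℝ →+* 𝕜)
    (v : (Σ i, Fin (p i)) → 𝕜) (a : Σ i, Fin (p i)) :
    (G.Rbar.map f *ᵥ v) a =
      (∑ j, (G.RbarBlock a.1 j).map f *ᵥ fun l => v ⟨j, l⟩) a.2 := by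
  simp only [Matrix.mulVec, dotProduct, Fintype.sum_sigma, Finset.sum_apply]
  rfl

/-- The pseudo-gradient component `(R̄ y + Q̄)_i`. -/
def pseudoGrad (i : Fin N) (y : ∀ j, Fin (p j) → ℝ) : Fin (p i) → ℝ :=
  ∑ j, G.RbarBlock i j *ᵥ y j + G.Q i

lemma Rbar_mulVec_stack_add_Qbar (y : ∀ j, Fin (p j) → ℝ) :
    G.Rbar *ᵥ stack y + G.Qbar = stack fun i => G.pseudoGrad i y := by
  funext a
  have := G.Rbar_map_mulVec_apply (RingHom.id ℝ) (stack y) a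
  simp only [RingHom.coe_id, Matrix.map_id] at this
  rw [Pi.add_apply, this]
  rfl

lemma Rbar_mulVec_stack_add_Qbar_eq_zero_iff (y : ∀ j, Fin (p j) → ℝ) :
    G.Rbar *ᵥ stack y + G.Qbar = 0 ↔ ∀ i, G.pseudoGrad i y = 0 := by
  rw [Rbar_mulVec_stack_add_Qbar]
  exact ⟨fun h i => funext fun k => congrFun h ⟨i, k⟩,
    fun h => funext fun a => congrFun (h a.1) a.2⟩

/-- An exact second-order Taylor formula in agent `i`'s own output; the terms in `W` involve only
the other agents and cancel. -/
lemma cost_update_add (i : Fin N) (y : ∀ j, Fin (p j) → ℝ) (d : Fin (p i) → ℝ) :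
    G.cost i (Function.update y i (y i + d)) =
      G.cost i y + d ⬝ᵥ G.pseudoGrad i y + d ⬝ᵥ (G.R i i *ᵥ d) := by
  have hsum : ∑ j, G.RbarBlock i j *ᵥ y j =
      (G.R i i + (G.R i i)ᵀ) *ᵥ y i + ∑ j ∈ Finset.univ.erase i, G.R i j *ᵥ y j := by
    rw [← Finset.add_sum_erase _ _ (Finset.mem_univ i)]
    congr 1
    · simp [RbarBlock]
    · refine Finset.sum_congr rfl fun j hj => ?_
      rw [RbarBlock, if_neg (Finset.ne_of_mem_erase hj).symm]
  have hoff : ∑ j ∈ Finset.univ.erase i,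
        ((y i + d) ⬝ᵥ (G.R i j *ᵥ Function.update y i (y i + d) j) +
          Function.update y i (y i + d) j ⬝ᵥ (G.W i j *ᵥ Function.update y i (y i + d) j)) =
      ∑ j ∈ Finset.univ.erase i, (y i ⬝ᵥ (G.R i j *ᵥ y j) + y j ⬝ᵥ (G.W i j *ᵥ y j)) +
        d ⬝ᵥ ∑ j ∈ Finset.univ.erase i, G.R i j *ᵥ y j := by
    rw [dotProduct_sum, ← Finset.sum_add_distrib]
    refine Finset.sum_congr rfl fun j hj => ?_
    rw [Function.update_of_ne (Finset.ne_of_mem_erase hj), add_dotProduct]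
    ring
  have htr : d ⬝ᵥ ((G.R i i)ᵀ *ᵥ y i) = y i ⬝ᵥ (G.R i i *ᵥ d) := by
    rw [Matrix.mulVec_transpose, dotProduct_comm, ← Matrix.dotProduct_mulVec]
  unfold cost pseudoGrad
  rw [Function.update_self, hoff, hsum]
  simp only [Matrix.mulVec_add, Matrix.add_mulVec, dotProduct_add, add_dotProduct, htr,
    dotProduct_comm d (G.Q i)]
  ring

lemma hasDerivAt_cost (i : Fin N) (y : ∀ j, Fin (p j) → ℝ) (k : Fin (p i)) :
    HasDerivAt (fun s => G.cost i (Function.update y i (Function.update (y i) k s)))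
      (G.pseudoGrad i y k) (y i k) := by
  have h : (fun s => G.cost i (Function.update y i (Function.update (y i) k s))) =
      fun s => G.cost i y + (s - y i k) * G.pseudoGrad i y k +
        (s - y i k) ^ 2 * G.R i i k k := by
    funext s
    have hs : Function.update (y i) k s = y i + Pi.single k (s - y i k) := by
      funext l
      by_cases hl : l = k
      · subst hl; simp
      · simp [hl]
    rw [hs, cost_update_add, single_dotProduct, single_dotProduct, Matrix.mulVec_single]
    simp
    ring
  rw [h]
  have h1 : HasDerivAt (fun s : ℝ => s - y i k) 1 (y i k) := (hasDerivAt_id _).sub_const _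
  refine (((h1.mul_const (G.pseudoGrad i y k)).const_add (G.cost i y)).add
    ((h1.pow 2).mul_const (G.R i i k k))).congr_deriv ?_
  simp

lemma partialGrad_eq_pseudoGrad (i : Fin N) (y : ∀ j, Fin (p j) → ℝ) :
    G.partialGrad i y = G.pseudoGrad i y :=
  funext fun k => (G.hasDerivAt_cost i y k).deriv

variable {G}

/-- A Nash point is critical in each own coordinate. Conversely, at a zero of the pseudo-gradient a
deviation `d` changes the cost by exactly `dᵀ R_ii d`, which is nonnegative. -/
lemma isNash_iff (hR : ∀ i, IsPosDefForm (G.R i i)) (y : ∀ j, Fin (p j) → ℝ) :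
    G.IsNash y ↔ G.Rbar *ᵥ stack y + G.Qbar = 0 := by
  rw [Rbar_mulVec_stack_add_Qbar_eq_zero_iff]
  constructor
  · intro h i
    funext k
    refine IsLocalMin.hasDerivAt_eq_zero (Filter.Eventually.of_forall fun s => ?_)
      (G.hasDerivAt_cost i y k)
    simpa using h i (Function.update (y i) k s)
  · intro h i v
    have h1 := G.cost_update_add i y (v - y i)
    rw [add_sub_cancel, h i, dotProduct_zero, add_zero] at h1
    rw [h1]
    by_cases hv : v - y i = 0
    · simp [hv]
    · linarith [hR i _ hv]

lemma eq_of_Rbar_mulVec_stack_add_Qbar_eq_zero (hR : IsPosDefForm G.Rbar)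
    {y y' : ∀ j, Fin (p j) → ℝ} (h : G.Rbar *ᵥ stack y + G.Qbar = 0)
    (h' : G.Rbar *ᵥ stack y' + G.Qbar = 0) : y = y' := by
  have h0 : stack y - stack y' = 0 := by
    by_contra hne
    have := hR _ hne
    rw [Matrix.mulVec_sub, add_right_cancel (h.trans h'.symm), sub_self, dotProduct_zero] at this
    exact lt_irrefl _ this
  funext i k
  exact congrFun (sub_eq_zero.1 h0) ⟨i, k⟩

end NetworkGame

/-! ### The closed loop: nominal stability, continuity in `μ`, and convergence. -/

namespace NetworkGame

variable {N : ℕ} {n m p : Fin N → ℕ} (G : NetworkGame N n m p)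

section ClosedLoop

variable {𝕜 : Type*} [CommRing 𝕜] (f : ℝ →+* 𝕜) (g : Gains N n m p) (μ : Uncertainty N n m p)
  (w : (Σ i, Fin (n i)) ⊕ (Σ i, Fin (n i) ⊕ Fin (p i)) → 𝕜)

lemma closedLoopMatrix_map_mulVec_inl (i : Fin N) (k : Fin (n i)) :
    ((G.closedLoopMatrix g μ).map f *ᵥ w) (Sum.inl ⟨i, k⟩) =
      ((G.Aμ μ i).map f *ᵥ (fun l => w (Sum.inl ⟨i, l⟩)) +
        (G.Bμ μ i).map f *ᵥ ((g.K i).map f *ᵥ fun l => w (Sum.inr ⟨i, l⟩))) k := by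
  rw [closedLoopMatrix, Matrix.fromBlocks_map, Matrix.fromBlocks_mulVec, Sum.elim_inl,
    Matrix.blockDiagonal'_map _ _ (map_zero f), Matrix.blockDiagonal'_map _ _ (map_zero f),
    Pi.add_apply, Matrix.blockDiagonal'_mulVec_apply, Matrix.blockDiagonal'_mulVec_apply,
    Matrix.map_mul, ← Matrix.mulVec_mulVec]
  rfl

lemma closedLoopMatrix_map_mulVec_inr (i : Fin N) (k : Fin (n i) ⊕ Fin (p i)) :
    ((G.closedLoopMatrix g μ).map f *ᵥ w) (Sum.inr ⟨i, k⟩) =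
      ((g.M₂ i).map f *ᵥ (∑ j, (G.RbarBlock i j).map f *ᵥ
          ((G.Cμ μ j).map f *ᵥ fun l => w (Sum.inl ⟨j, l⟩))) +
        (G.M₁ g i).map f *ᵥ fun l => w (Sum.inr ⟨i, l⟩)) k := by
  rw [closedLoopMatrix, Matrix.fromBlocks_map, Matrix.fromBlocks_mulVec, Sum.elim_inr,
    Matrix.map_mul, Matrix.map_mul,
    Matrix.blockDiagonal'_map _ _ (map_zero f), Matrix.blockDiagonal'_map _ _ (map_zero f),
    Matrix.blockDiagonal'_map _ _ (map_zero f),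
    Pi.add_apply, ← Matrix.mulVec_mulVec, ← Matrix.mulVec_mulVec,
    Matrix.blockDiagonal'_mulVec_apply, Matrix.blockDiagonal'_mulVec_apply, Pi.add_apply]
  congr 3
  funext l
  rw [Rbar_map_mulVec_apply]
  simp only [Matrix.blockDiagonal'_mulVec_apply]
  rfl

end ClosedLoop

lemma continuous_closedLoopMatrix (g : Gains N n m p) : Continuous (G.closedLoopMatrix g) := by
  have hA : Continuous G.Aμ := continuous_pi fun i =>
    continuous_const.add (continuous_apply i).fst
  have hB : Continuous G.Bμ := continuous_pi fun i =>
    continuous_const.add (continuous_apply i).snd.fst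
  have hC : Continuous G.Cμ := continuous_pi fun i =>
    continuous_const.add (continuous_apply i).snd.snd
  refine Continuous.matrix_fromBlocks hA.matrix_blockDiagonal' ?_
    (continuous_const.matrix_mul hC.matrix_blockDiagonal') continuous_const
  exact Continuous.matrix_blockDiagonal' <| continuous_pi fun i =>
    ((continuous_apply i).comp hB).matrix_mul continuous_const

variable {G}

lemma RbarBlock_eq_zero (hcost : G.CostsRespectGraph) {i j : Fin N} (hij : j ≠ i)
    (h : ¬ G.edge j i) : G.RbarBlock i j = 0 := by
  rw [RbarBlock, if_neg hij.symm, (hcost i j hij h).1]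

/-- On finitely many vertices, absence of cycles permits induction from the neighbors of an agent to
the agent. -/
lemma wellFounded_edge (hgraph : G.GraphAcyclic) : WellFounded G.edge := by
  have : Std.Irrefl (Relation.TransGen G.edge) := ⟨hgraph⟩
  exact Subrelation.wf Relation.TransGen.single
    (Finite.wellFounded_of_trans_of_irrefl (Relation.TransGen G.edge))

/-- Over an acyclic graph the nominal closed loop inherits stability from the isolated agents. -/
lemma isHurwitz_closedLoopMatrix_zero (hcost : G.CostsRespectGraph) (hgraph : G.GraphAcyclic)
    (g : Gains N n m p)
    (hagent : ∀ (i : Fin N) (z : ℂ), 0 ≤ z.re →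
      ∀ (x ξ : Fin (n i) → ℂ) (ζ : Fin (p i) → ℂ),
        (G.A i).map (algebraMap ℝ ℂ) *ᵥ x + (G.B i).map (algebraMap ℝ ℂ) *ᵥ
          ((g.K₁ i).map (algebraMap ℝ ℂ) *ᵥ ξ + (g.K₂ i).map (algebraMap ℝ ℂ) *ᵥ ζ) = z • x →
        (g.L i).map (algebraMap ℝ ℂ) *ᵥ
            (((G.R i i + (G.R i i)ᵀ) * G.C i).map (algebraMap ℝ ℂ) *ᵥ x) +
          ((G.A i + G.B i * g.K₁ i - g.L i * (G.R i i + (G.R i i)ᵀ) * G.C i).map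
              (algebraMap ℝ ℂ) *ᵥ ξ +
            (G.B i * g.K₂ i).map (algebraMap ℝ ℂ) *ᵥ ζ) = z • ξ →
        ((G.R i i + (G.R i i)ᵀ) * G.C i).map (algebraMap ℝ ℂ) *ᵥ x = z • ζ →
        x = 0 ∧ ξ = 0 ∧ ζ = 0) :
    IsHurwitz (G.closedLoopMatrix g 0) := by
  rw [isHurwitz_iff]
  intro z hz w hw
  suffices h : ∀ i, (fun l => w (Sum.inl ⟨i, l⟩)) = 0 ∧ (fun l => w (Sum.inr ⟨i, l⟩)) = 0 by
    funext a
    rcases a with ⟨i, k⟩ | ⟨i, k⟩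
    · exact congrFun (h i).1 k
    · exact congrFun (h i).2 k
  intro i
  induction i using (wellFounded_edge hgraph).induction with
  | _ i ih =>
  set x : Fin (n i) → ℂ := fun l => w (Sum.inl ⟨i, l⟩) with hx
  set ξ : Fin (n i) → ℂ := fun l => w (Sum.inr ⟨i, Sum.inl l⟩) with hξ
  set ζ : Fin (p i) → ℂ := fun l => w (Sum.inr ⟨i, Sum.inr l⟩) with hζ
  have hA : G.Aμ 0 = G.A := by funext j; simp [Aμ]
  have hB : G.Bμ 0 = G.B := by funext j; simp [Bμ]
  have hC : G.Cμ 0 = G.C := by funext j; simp [Cμ]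
  have hsum : ∑ j, (G.RbarBlock i j).map (algebraMap ℝ ℂ) *ᵥ
      ((G.C j).map (algebraMap ℝ ℂ) *ᵥ fun l => w (Sum.inl ⟨j, l⟩)) =
      ((G.R i i + (G.R i i)ᵀ) * G.C i).map (algebraMap ℝ ℂ) *ᵥ x := by
    rw [Finset.sum_eq_single i]
    · rw [RbarBlock, if_pos rfl, Matrix.map_mul, ← Matrix.mulVec_mulVec]
    · intro j _ hj
      -- A neighbor contributes nothing by induction, a non-neighbor because its block of `R̄` is
      -- zero.
      by_cases he : G.edge j i
      · rw [(ih j he).1, Matrix.mulVec_zero, Matrix.mulVec_zero]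
      · rw [RbarBlock_eq_zero hcost hj he, Matrix.map_zero _ (map_zero _), Matrix.zero_mulVec]
    · simp
  have h1 : ∀ k, _ := fun k =>
    (G.closedLoopMatrix_map_mulVec_inl (algebraMap ℝ ℂ) g 0 w i k).symm.trans
      (congrFun hw (Sum.inl ⟨i, k⟩))
  have h2 : ∀ k, _ := fun k =>
    (G.closedLoopMatrix_map_mulVec_inr (algebraMap ℝ ℂ) g 0 w i k).symm.trans
      (congrFun hw (Sum.inr ⟨i, k⟩))
  rw [hA, hB] at h1
  rw [hC, hsum] at h2
  have hηl : (fun l => w (Sum.inr ⟨i, l⟩)) ∘ Sum.inl = ξ := rfl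
  have hηr : (fun l => w (Sum.inr ⟨i, l⟩)) ∘ Sum.inr = ζ := rfl
  rw [Gains.K, Matrix.fromCols_map, Matrix.fromCols_mulVec, hηl, hηr] at h1
  rw [Gains.M₂, Matrix.fromRows_map, Matrix.fromRows_mulVec, M₁, Matrix.fromBlocks_map,
    Matrix.fromBlocks_mulVec, hηl, hηr] at h2
  obtain ⟨hx0, hξ0, hζ0⟩ := hagent i z hz x ξ ζ (funext h1) (funext fun k => h2 (Sum.inl k))
    (funext fun k => by simpa using h2 (Sum.inr k))
  refine ⟨hx0, ?_⟩
  rw [← Sum.elim_comp_inl_inr (fun l => w (Sum.inr ⟨i, l⟩)), hηl, hηr, hξ0, hζ0]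
  exact Sum.elim_zero_zero

/-- A stable closed loop drives the outputs to the zero of the pseudo-gradient. -/
lemma tendsto_output {g : Gains N n m p} {μ : Uncertainty N n m p}
    (hM : IsHurwitz (G.closedLoopMatrix g μ)) (hR : IsPosDefForm G.Rbar)
    {ystar : ∀ i, Fin (p i) → ℝ} (hy : G.Rbar *ᵥ stack ystar + G.Qbar = 0)
    {x : ∀ i, ℝ → Fin (n i) → ℝ} {η : ∀ i, ℝ → Fin (n i) ⊕ Fin (p i) → ℝ}
    (h : G.IsTrajectory g μ x η) :
    Tendsto (fun t => G.output μ fun i => x i t) atTop (𝓝 ystar) := by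
  set M := G.closedLoopMatrix g μ with hMdef
  let w : ℝ → (Σ i, Fin (n i)) ⊕ (Σ i, Fin (n i) ⊕ Fin (p i)) → ℝ := fun t =>
    Sum.elim (fun a => x a.1 t a.2) (fun a => η a.1 t a.2)
  -- The constant forcing is the affine part `Q̄` of the pseudo-gradient, injected through `M₂`.
  let b : (Σ i, Fin (n i)) ⊕ (Σ i, Fin (n i) ⊕ Fin (p i)) → ℝ :=
    Sum.elim 0 (fun a => (g.M₂ a.1 *ᵥ G.Q a.1) a.2)
  have hinl := fun v i k => G.closedLoopMatrix_map_mulVec_inl (RingHom.id ℝ) g μ v i k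
  have hinr := fun v i k => G.closedLoopMatrix_map_mulVec_inr (RingHom.id ℝ) g μ v i k
  simp only [RingHom.coe_id, Matrix.map_id, ← hMdef] at hinl hinr
  set w₀ := -(M⁻¹ *ᵥ b) with hw₀def
  have hw₀ : M *ᵥ w₀ + b = 0 := by
    rw [hw₀def, Matrix.mulVec_neg, Matrix.mulVec_mulVec, Matrix.mul_nonsing_inv _ hM.isUnit_det,
      Matrix.one_mulVec, neg_add_cancel]
  have hw : ∀ t ∈ Set.Ici (0 : ℝ), HasDerivWithinAt w (M *ᵥ w t + b) (Set.Ici 0) t := by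
    intro t ht
    rw [hasDerivWithinAt_pi]
    rintro (⟨i, k⟩ | ⟨i, k⟩)
    · refine (hasDerivWithinAt_pi.1 (h i t ht).1 k).congr_deriv ?_
      rw [Pi.add_apply (M *ᵥ w t), hinl]
      exact (add_zero _).symm
    · refine (hasDerivWithinAt_pi.1 (h i t ht).2 k).congr_deriv ?_
      rw [Pi.add_apply (M *ᵥ w t), hinr, partialGrad_eq_pseudoGrad, pseudoGrad, Matrix.mulVec_add]
      simp only [Pi.add_apply]
      rw [add_comm, add_right_comm]
      rfl
  have hlim := hM.tendsto_equilibrium hw₀ hw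
  let x₀ : ∀ i, Fin (n i) → ℝ := fun i l => w₀ (Sum.inl ⟨i, l⟩)
  have hx : Tendsto (fun t i => x i t) atTop (𝓝 x₀) :=
    tendsto_pi_nhds.2 fun i => tendsto_pi_nhds.2 fun k =>
      tendsto_pi_nhds.1 hlim (Sum.inl ⟨i, k⟩)
  have hout : Continuous (G.output μ) := continuous_pi fun i =>
    continuous_const.matrix_mulVec (continuous_apply i)
  have hy₀ : G.output μ x₀ = ystar := by
    refine eq_of_Rbar_mulVec_stack_add_Qbar_eq_zero hR ?_ hy
    rw [Rbar_mulVec_stack_add_Qbar_eq_zero_iff]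
    intro i
    funext k
    -- In the integrator rows `M₁` is zero and `M₂` is the identity, so the equilibrium equation
    -- there says that the pseudo-gradient vanishes, whatever `μ` is.
    have h0 := congrFun hw₀ (Sum.inr ⟨i, Sum.inr k⟩)
    rw [Pi.add_apply, hinr, Gains.M₂, Matrix.fromRows_mulVec, M₁, Matrix.fromBlocks_mulVec] at h0
    simpa [b, x₀, Gains.M₂, Matrix.fromRows_mulVec, pseudoGrad, output] using h0
  rw [← hy₀]
  exact (hout.tendsto x₀).comp hx

end NetworkGame
theorem corollary1 {N : ℕ} {n m p : Fin N → ℕ} (G : NetworkGame N n m p)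
    -- the cost functions: `R_ii > 0`, and `J_i` depends only on `y_i` and the neighbors' outputs
    (hRii : ∀ i, IsPosDefForm (G.R i i))
    (hcost : G.CostsRespectGraph)
    -- `R̄` is positive definite (part of the Nash equilibrium seeking problem)
    (hRbar : IsPosDefForm G.Rbar)
    -- stabilizability and detectability of the nominal agents
    (hstab : ∀ i, IsStabilizable (G.A i) (G.B i))
    (hdet : ∀ i, IsDetectable (G.A i) (G.C i))
    -- rank condition at `λ = 0`, the only frequency of the disturbance-free exosystem
    (hrank : ∀ i, (Matrix.fromBlocks (G.A i) (G.B i) (G.C i) 0).rank = n i + p i)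
    -- the communication digraph has no loop
    (hgraph : G.GraphAcyclic) :
    -- there is a unique Nash equilibrium `y*`, it satisfies `R̄ y* + Q̄ = 0`, and
    ∃ ystar : ∀ i, Fin (p i) → ℝ,
      (G.IsNash ystar ∧ ∀ y, G.IsNash y → y = ystar) ∧
      G.Rbar *ᵥ stack ystar + G.Qbar = 0 ∧
      -- there are gains, independent of the uncertainty, such that
      ∃ g : Gains N n m p,
        (∀ i, IsHurwitz (G.A i - g.L i * (G.R i i + (G.R i i)ᵀ) * G.C i)) ∧
        -- for all `μ` in a neighborhood of `0`, the closed loop is stable and `y(t) → y*`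
        ∀ᶠ μ in 𝓝 (0 : Uncertainty N n m p),
          IsHurwitz (G.closedLoopMatrix g μ) ∧
          ∀ (x : ∀ i, ℝ → Fin (n i) → ℝ) (η : ∀ i, ℝ → Fin (n i) ⊕ Fin (p i) → ℝ),
            G.IsTrajectory g μ x η →
            Tendsto (fun t => G.output μ fun i => x i t) atTop (𝓝 ystar) := by
  have hS : ∀ i, IsUnit (G.R i i + (G.R i i)ᵀ).det := fun i => (hRii i).add_transpose.isUnit_det
  choose L K₁ K₂ hL hagent using fun i =>
    exists_stabilizing_gains (hS i) (hstab i) (hdet i) (hrank i)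
  let v : (Σ i, Fin (p i)) → ℝ := -(G.Rbar⁻¹ *ᵥ G.Qbar)
  let ystar : ∀ i, Fin (p i) → ℝ := fun i k => v ⟨i, k⟩
  have hy : G.Rbar *ᵥ stack ystar + G.Qbar = 0 := by
    change G.Rbar *ᵥ v + G.Qbar = 0
    rw [Matrix.mulVec_neg, Matrix.mulVec_mulVec, Matrix.mul_nonsing_inv _ hRbar.isUnit_det,
      Matrix.one_mulVec, neg_add_cancel]
  have hnash := NetworkGame.isNash_iff hRii
  refine ⟨ystar, ⟨(hnash _).2 hy, fun y h =>
    NetworkGame.eq_of_Rbar_mulVec_stack_add_Qbar_eq_zero hRbar ((hnash y).1 h) hy⟩, hy,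
    ⟨L, K₁, K₂⟩, hL, ?_⟩
  have hM := NetworkGame.isHurwitz_closedLoopMatrix_zero hcost hgraph ⟨L, K₁, K₂⟩ hagent
  filter_upwards [(G.continuous_closedLoopMatrix ⟨L, K₁, K₂⟩).continuousAt.eventually
    hM.eventually] with μ hμ
  exact ⟨hμ, fun x η => NetworkGame.tendsto_output hμ hRbar hy⟩
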